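/- Let $\sigma=(\lambda_1,\lambda_2,\lambda_3,\lambda_4,\lambda_5)$ be a list of real numbers with $\lambda_1\ge\lambda_2\ge\lambda_3\ge\lambda_4\ge\lambda_5\ge-\lambda_1$ and $\lambda_3\le\sum_{j=1}^5\lambda_j$. Suppose that $\sigma$ is the spectrum (the list of eigenvalues, counted with algebraic multiplicity) of a $5\times5$ real symmetric matrix with nonnegative entries. For a real number $s>0$ and $i\in\{2,3,4,5\}$, let $\sigma_i^{+s}$ be the list obtained from $\sigma$ by replacing $\lambda_1$ by $\lambda_1+s$ and $\lambda_i$ by $\lambda_i+s$, and let $\sigma_i^{-s}$ be the list obtained from $\sigma$ by replacing $\lambda_1$ by $\lambda_1+s$ and $\lambda_i$ by $\lambda_i-s$. Then, for every real number $s>0$ and every $i\in\{2,3,4,5\}$, each of $\sigma_i^{+s}$ and $\sigma_i^{-s}$ is the spectrum of a $5\times5$ real symmetric matrix with nonnegative entries. -/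

import Mathlib

namespace SNIEP

/-- The list `σ` is the spectrum of the square matrix `A`: its entries are the eigenvalues of `A`,
repeated according to algebraic multiplicity, i.e. the roots of the characteristic polynomial. -/
def HasSpectrum {n : ℕ} (A : Matrix (Fin n) (Fin n) ℝ) (σ : Fin n → ℝ) : Prop :=
  A.charpoly = ∏ i, (Polynomial.X - Polynomial.C (σ i))

/-- The list `σ` of `n` real numbers is the spectrum of an `n × n` symmetric (entrywise)
nonnegative matrix. -/
def SymmRealizable {n : ℕ} (σ : Fin n → ℝ) : Prop :=
  ∃ A : Matrix (Fin n) (Fin n) ℝ, A.IsSymm ∧ (∀ i j, 0 ≤ A i j) ∧ HasSpectrum A σ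

/-- The list `σ` with its first entry `σ 0` replaced by `σ 0 + s` and its entry `σ i`
replaced by `σ i + s` (for `i ≠ 0`). -/
def perturbPlus {n : ℕ} (σ : Fin (n + 1) → ℝ) (i : Fin (n + 1)) (s : ℝ) : Fin (n + 1) → ℝ :=
  fun j => if j = 0 then σ 0 + s else if j = i then σ i + s else σ j

/-- The list `σ` with its first entry `σ 0` replaced by `σ 0 + s` and its entry `σ i`
replaced by `σ i - s` (for `i ≠ 0`). -/
def perturbMinus {n : ℕ} (σ : Fin (n + 1) → ℝ) (i : Fin (n + 1)) (s : ℝ) : Fin (n + 1) → ℝ :=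
  fun j => if j = 0 then σ 0 + s else if j = i then σ i - s else σ j

end SNIEP

namespace SNIEP

open Matrix Finset

/-! ### Trace bounds from eigenvectors with few positive entries. -/

section Eigenvectors

/-! For a decreasing list with `-σ 0 ≤ σ 4` and `σ 2 ≤ ∑ σ`, realizability is equivalent to two
linear inequalities, `0 ≤ ∑ σ` and `σ 1 + σ 4 ≤ ∑ σ`. Necessity (`add_le_sum_of_symmRealizable`) is
a trace bound from an eigenvector with one or two positive entries; sufficiency
(`symmRealizable_of_sorted`) is an explicit construction. Either perturbation preserves all four
inequalities: raising `λ₁` by `s` pays for the change of the other entry. Since the new list may be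
out of order, `symmRealizable_of_bounds` restates sufficiency without sorting. -/

/-- If `y` is an eigenvector whose positive entries lie in positions `i`, `j`, the `2 × 2` principal
submatrix on `i`, `j` has trace at least the eigenvalue plus a lower bound of the quadratic form. -/
lemma add_le_diag_add_diag {ι : Type*} [Fintype ι] [DecidableEq ι] {A : Matrix ι ι ℝ}
    (hA : A.IsSymm) (hnn : ∀ i j, 0 ≤ A i j) {l μ : ℝ} (hl : ∀ x, l * (x ⬝ᵥ x) ≤ x ⬝ᵥ A *ᵥ x)
    {y : ι → ℝ} (hy : A *ᵥ y = μ • y) {i j : ι} (hij : i ≠ j) (hi : 0 < y i)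
    (hk : ∀ k, k ≠ i → k ≠ j → y k ≤ 0) : μ + l ≤ A i i + A j j := by
  obtain ⟨t, ht⟩ : ∃ t, t = max (y j) 0 := ⟨_, rfl⟩
  have ht0 : 0 ≤ t := ht ▸ le_max_right _ _
  have htj : y j ≤ t := ht ▸ le_max_left _ _
  have htt : t * (μ * y j) = μ * (t * t) := by
    rcases max_choice (y j) 0 with h | h <;> rw [h] at ht <;> rw [ht] <;> ring
  have row : ∀ r, μ * y r ≤ A r i * y i + A r j * t := by
    intro r
    have h : ∑ k, A r k * y k = μ * y r := by simpa [mulVec, dotProduct] using congrFun hy r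
    have hpair := Finset.sum_pair (f := fun k => A r k * y k) hij
    have hsplit := Finset.sum_add_sum_compl {i, j} (fun k => A r k * y k)
    have : ∑ k ∈ ({i, j} : Finset ι)ᶜ, A r k * y k ≤ 0 := by
      refine Finset.sum_nonpos fun k hk' => ?_
      simp only [mem_compl, mem_insert, mem_singleton, not_or] at hk'
      exact mul_nonpos_of_nonneg_of_nonpos (hnn r k) (hk k hk'.1 hk'.2)
    have := mul_le_mul_of_nonneg_left htj (hnn r j)
    linarith
  have h1 := mul_le_mul_of_nonneg_left (row i) hi.le
  have h2 := mul_le_mul_of_nonneg_left (row j) ht0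
  -- This test vector is orthogonal to `(y i, t)` and of equal norm, so the two values of the
  -- quadratic form add up to the `2 × 2` trace times `y i ^ 2 + t ^ 2`.
  have h3 := hl (Pi.single i (-t) + Pi.single j (y i))
  have hs : A j i = A i j := hA.apply i j
  simp [mulVec_add, dotProduct_add, add_dotProduct, hij, hij.symm, hs] at h3
  rw [hs, htt] at h2
  have h4 : 0 < y i * y i + t * t := by positivity
  refine le_of_mul_le_mul_right ?_ h4
  linarith

lemma exists_pair_of_card_pos_le_two {ι : Type*} [Fintype ι] [Nontrivial ι] {y : ι → ℝ}
    (h1 : 1 ≤ #{i | 0 < y i}) (h2 : #{i | 0 < y i} ≤ 2) :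
    ∃ i j, i ≠ j ∧ 0 < y i ∧ ∀ k, k ≠ i → k ≠ j → y k ≤ 0 := by
  classical
  obtain h | h : #{i | 0 < y i} = 1 ∨ #{i | 0 < y i} = 2 := by omega
  · obtain ⟨i, hi⟩ := Finset.card_eq_one.1 h
    obtain ⟨j, hj⟩ := exists_ne i
    have hm : ∀ k, 0 < y k ↔ k = i := fun k => by simpa using Finset.ext_iff.1 hi k
    exact ⟨i, j, hj.symm, (hm i).2 rfl, fun k hk _ => not_lt.1 fun h => hk ((hm k).1 h)⟩
  · obtain ⟨i, j, hij, hi⟩ := Finset.card_eq_two.1 h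
    have hm : ∀ k, 0 < y k ↔ k = i ∨ k = j := fun k => by simpa using Finset.ext_iff.1 hi k
    exact ⟨i, j, hij, (hm i).2 (Or.inl rfl), fun k hk hk' => not_lt.1 fun h =>
      ((hm k).1 h).elim hk hk'⟩

end Eigenvectors

/-! ### Realizing matrices. -/

section Construction

open Polynomial

/-- The vectors `(1,-1,0,0,0)` and `(0,0,0,1,-1)` split off `p - q` and `e - f`; the cubic belongs
to the quotient on the block-constant vectors. -/
lemma charpoly_three_blocks (p q e f k m y z : ℝ) :
    (!![p, q, k, y, y; q, p, k, y, y; k, k, m, z, z; y, y, z, e, f; y, y, z, f, e] :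
      Matrix (Fin 5) (Fin 5) ℝ).charpoly =
    (X - C (p - q)) * (X - C (e - f)) *
      ((X - C (p + q)) * (X - C m) * (X - C (e + f)) - (X - C (e + f)) * (2 * C k ^ 2)
        - (X - C m) * (4 * C y ^ 2) - (X - C (p + q)) * (2 * C z ^ 2)
        - 8 * C k * C y * C z) := by
  simp [Matrix.charpoly, Matrix.charmatrix, Matrix.det_succ_row_zero, Fin.sum_univ_succ,
    Matrix.submatrix, Fin.succAbove, Matrix.diagonal, Matrix.scalar]
  ring

/-- A nonnegative symmetric `3 × 3` matrix with eigenvalues `a`, `b`, `c` can be enlarged by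
replacing its diagonal entries `P` and `R` with `2 × 2` matrices of eigenvalues `P, μ` and
`R, δ`. -/
lemma symmRealizable_of_three {P R m k y z a b c μ δ : ℝ} (hP : |μ| ≤ P) (hR : |δ| ≤ R)
    (hm : 0 ≤ m) (hk : 0 ≤ k) (hy : 0 ≤ y) (hz : 0 ≤ z) (h1 : P + m + R = a + b + c)
    (h2 : P * m + P * R + m * R - k ^ 2 - y ^ 2 - z ^ 2 = a * b + a * c + b * c)
    (h3 : P * m * R + 2 * (k * y * z) - P * z ^ 2 - m * y ^ 2 - R * k ^ 2 = a * b * c) :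
    SymmRealizable ![a, b, c, μ, δ] := by
  obtain ⟨hP1, hP2⟩ := abs_le.1 hP
  obtain ⟨hR1, hR2⟩ := abs_le.1 hR
  have hs : √2 ^ 2 = 2 := Real.sq_sqrt (by norm_num)
  have hs0 : 0 ≤ √2 := Real.sqrt_nonneg 2
  obtain ⟨p, hp⟩ : ∃ p, p = (P + μ) / 2 := ⟨_, rfl⟩
  obtain ⟨q, hq⟩ : ∃ q, q = (P - μ) / 2 := ⟨_, rfl⟩
  obtain ⟨e, he⟩ : ∃ e, e = (R + δ) / 2 := ⟨_, rfl⟩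
  obtain ⟨f, hf⟩ : ∃ f, f = (R - δ) / 2 := ⟨_, rfl⟩
  -- Scaled so that the quotient in the orthonormal block basis has off-diagonal entries `k`, `y`,
  -- `z`.
  obtain ⟨k', hk'⟩ : ∃ k', k' = k * √2 / 2 := ⟨_, rfl⟩
  obtain ⟨y', hy'⟩ : ∃ y', y' = y / 2 := ⟨_, rfl⟩
  obtain ⟨z', hz'⟩ : ∃ z', z' = z * √2 / 2 := ⟨_, rfl⟩
  have p0 : 0 ≤ p := by linarith
  have q0 : 0 ≤ q := by linarith
  have e0 : 0 ≤ e := by linarith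
  have f0 : 0 ≤ f := by linarith
  have k0 : 0 ≤ k' := by rw [hk']; positivity
  have y0 : 0 ≤ y' := by rw [hy']; positivity
  have z0 : 0 ≤ z' := by rw [hz']; positivity
  refine ⟨!![p, q, k', y', y'; q, p, k', y', y'; k', k', m, z', z'; y', y', z', e, f;
    y', y', z', f, e], ?_, ?_, ?_⟩
  · ext i j
    fin_cases i <;> fin_cases j <;> rfl
  · intro i j
    fin_cases i <;> fin_cases j <;> assumption
  · have g2 : P * m + P * R + m * R - 2 * k' ^ 2 - 4 * y' ^ 2 - 2 * z' ^ 2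
        = a * b + a * c + b * c := by
      rw [← h2, hk', hy', hz']
      linear_combination (-(k ^ 2 + z ^ 2) / 2) * hs
    have g3 : P * m * R + 8 * (k' * y' * z') - P * (2 * z' ^ 2) - m * (4 * y' ^ 2)
        - R * (2 * k' ^ 2) = a * b * c := by
      rw [← h3, hk', hy', hz']
      linear_combination (k * y * z - P * z ^ 2 / 2 - R * k ^ 2 / 2) * hs
    have c1 := congrArg C h1
    have c2 := congrArg C g2
    have c3 := congrArg C g3
    simp only [C_add, C_sub, C_mul, C_pow, C_ofNat] at c1 c2 c3
    rw [HasSpectrum, charpoly_three_blocks, show p + q = P by rw [hp, hq]; ring,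
      show e + f = R by rw [he, hf]; ring, show p - q = μ by rw [hp, hq]; ring,
      show e - f = δ by rw [he, hf]; ring]
    simp [Fin.prod_univ_succ]
    linear_combination ((X - C μ) * (X - C δ)) * (-X ^ 2 * c1 + X * c2 - c3)

lemma SymmRealizable.of_comp_perm {n : ℕ} {σ : Fin n → ℝ} (τ : Equiv.Perm (Fin n))
    (h : SymmRealizable (σ ∘ τ)) : SymmRealizable σ := by
  obtain ⟨A, h1, h2, h3⟩ := h
  refine ⟨A, h1, h2, ?_⟩
  rw [HasSpectrum, h3]
  exact Equiv.prod_comp τ fun i => X - C (σ i)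

/-- Sufficient conditions for a decreasing list to be realizable. -/
lemma symmRealizable_of_sorted {σ : Fin 5 → ℝ} (hσ : Antitone σ) (hlow : -σ 0 ≤ σ 4)
    (hsum : 0 ≤ ∑ j, σ j) (hthird : σ 2 ≤ ∑ j, σ j) (hMN : σ 1 + σ 4 ≤ ∑ j, σ j) :
    SymmRealizable σ := by
  have h01 : σ 1 ≤ σ 0 := hσ (by decide)
  have h12 : σ 2 ≤ σ 1 := hσ (by decide)
  have h23 : σ 3 ≤ σ 2 := hσ (by decide)
  have h34 : σ 4 ≤ σ 3 := hσ (by decide)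
  simp only [Fin.sum_univ_five] at hsum hthird hMN
  rcases le_or_gt 0 (σ 2) with h | h
  · suffices SymmRealizable ![σ 0, σ 1, σ 2, σ 4, σ 3] by
      refine SymmRealizable.of_comp_perm (Equiv.swap 3 4) ?_
      convert this using 1
      ext i
      fin_cases i <;> rfl
    rcases le_or_gt 0 (σ 1 + σ 3) with h' | h'
    · refine symmRealizable_of_three (P := σ 0) (R := σ 1) (m := σ 2) (k := 0) (y := 0) (z := 0)
        (abs_le.2 ⟨?_, ?_⟩) (abs_le.2 ⟨?_, ?_⟩) h le_rfl le_rfl le_rfl ?_ ?_ ?_ <;> linarith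
    · have hy : 0 ≤ -(σ 0 + σ 3) * (σ 1 + σ 3) :=
        mul_nonneg_of_nonpos_of_nonpos (by linarith) h'.le
      have hys := Real.sq_sqrt hy
      -- `R` is the least value allowed by `|σ 3| ≤ R`; `P` and `y` then force the eigenvalues `σ 0,
      -- σ 1`. The bound `-σ 4 ≤ P` is exactly `hthird`.
      refine symmRealizable_of_three (P := σ 0 + σ 1 + σ 3) (R := -σ 3) (m := σ 2) (k := 0)
        (y := √(-(σ 0 + σ 3) * (σ 1 + σ 3))) (z := 0)
        (abs_le.2 ⟨?_, ?_⟩) (abs_le.2 ⟨?_, ?_⟩) h le_rfl (Real.sqrt_nonneg _) le_rfl ?_ ?_ ?_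
      any_goals linarith
      · linear_combination -σ 2 * hys
  · rcases le_or_gt 0 (σ 1 + σ 4) with h' | h'
    · suffices SymmRealizable ![σ 0, σ 1, σ 3, σ 2, σ 4] by
        refine SymmRealizable.of_comp_perm (Equiv.swap 2 3) ?_
        convert this using 1
        ext i
        fin_cases i <;> rfl
      have hk : 0 ≤ (-σ 2) * (σ 0 + σ 2 + σ 3) + σ 0 * (-σ 3) := by
        refine add_nonneg (mul_nonneg ?_ ?_) (mul_nonneg ?_ ?_) <;> linarith
      have hks := Real.sq_sqrt hk
      -- The `P, m` block has eigenvalues `σ 0, σ 3`, and `0 ≤ m` is exactly `hMN`.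
      refine symmRealizable_of_three (P := -σ 2) (R := σ 1) (m := σ 0 + σ 2 + σ 3)
        (k := √((-σ 2) * (σ 0 + σ 2 + σ 3) + σ 0 * (-σ 3))) (y := 0) (z := 0)
        (abs_le.2 ⟨?_, ?_⟩) (abs_le.2 ⟨?_, ?_⟩) ?_ (Real.sqrt_nonneg _) le_rfl le_rfl ?_ ?_ ?_
      any_goals linarith
      · linear_combination -σ 1 * hks
    · suffices SymmRealizable ![σ 0, σ 1, σ 3, σ 2, σ 4] by
        refine SymmRealizable.of_comp_perm (Equiv.swap 2 3) ?_
        convert this using 1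
        ext i
        fin_cases i <;> rfl
      obtain ⟨b, hb⟩ : ∃ b, b = -σ 2 := ⟨_, rfl⟩
      obtain ⟨c, hc⟩ : ∃ c, c = -σ 3 := ⟨_, rfl⟩
      obtain ⟨α, hα⟩ : ∃ α, α = σ 0 + σ 1 + σ 4 := ⟨_, rfl⟩
      obtain ⟨r, hr⟩ : ∃ r, r = (σ 0 + σ 4) * -(σ 1 + σ 4) := ⟨_, rfl⟩
      have r0 : 0 ≤ r := by
        rw [hr]
        refine mul_nonneg ?_ ?_ <;> linarith
      have hαc : 0 < α + c := by linarith
      have hαb : 0 ≤ α - b := by linarith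
      have hbc : 0 ≤ b + c := by linarith
      -- the Perron vector of the leading `2 × 2` block is proportional to `(√(b+c), √(α-b))`
      have s1 := Real.sq_sqrt hαb
      have s2 := Real.sq_sqrt hbc
      have s3 : √(r / (α + c)) ^ 2 = r / (α + c) := Real.sq_sqrt (by positivity)
      have t1 := Real.sqrt_nonneg (α - b)
      have t2 := Real.sqrt_nonneg (b + c)
      have t3 := Real.sqrt_nonneg (r / (α + c))
      generalize √(α - b) = u at *
      generalize √(b + c) = v at *
      generalize √(r / (α + c)) = w at *
      have s4 : w ^ 2 * (α + c) = r := by rw [s3]; field_simp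
      have e0 : σ 0 + σ 1 + σ 3 = α - c - σ 4 := by rw [hα, hc]; ring
      have e3 : σ 3 = -c := by rw [hc]; ring
      have e2 : σ 2 = -b := by rw [hb]; ring
      have e1 : σ 0 * σ 1 = -α * σ 4 - r := by rw [hα, hr]; ring
      -- The leading block has eigenvalues `α, -c`. Coupling along its `α`-eigenvector keeps `-c = σ
      -- 3` and leaves a `2 × 2` matrix with diagonal `α, -σ 4` and squared off-diagonal entry `r`,
      -- whose eigenvalues are `σ 0, σ 1`. Here `m = ∑ σ`.
      refine symmRealizable_of_three (P := b) (R := -σ 4) (m := α - b - c)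
        (k := u * v) (y := w * v) (z := w * u)
        (abs_le.2 ⟨?_, ?_⟩) (abs_le.2 ⟨?_, ?_⟩) ?_ (by positivity) (by positivity)
        (by positivity) ?_ ?_ ?_
      any_goals linarith
      · have : σ 0 * σ 1 + σ 0 * σ 3 + σ 1 * σ 3 = -α * σ 4 - r - c * (α - σ 4) := by
          rw [e3, e1]
          rw [hα]; ring
        rw [this, mul_pow, mul_pow, mul_pow, s1, s2]
        linear_combination -s4
      · rw [e1, e3, show u * v * (w * v) * (w * u) = u ^ 2 * v ^ 2 * w ^ 2 by ring, mul_pow, mul_pow,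
          mul_pow, s1, s2]
        linear_combination c * s4

end Construction

/-! ### The trace inequality for realizable lists. -/

section Necessity

lemma HasSpectrum.map_eigenvalues {n : ℕ} {A : Matrix (Fin n) (Fin n) ℝ} {σ : Fin n → ℝ}
    (h : HasSpectrum A σ) (hA : A.IsHermitian) :
    Multiset.map hA.eigenvalues univ.val = Multiset.map σ univ.val := by
  have h1 := hA.roots_charpoly_eq_eigenvalues
  rw [h, Polynomial.roots_prod _ _
    (prod_ne_zero_iff.2 fun i _ => Polynomial.X_sub_C_ne_zero (σ i))] at h1
  simpa [Multiset.bind_singleton, Function.comp_def] using h1.symm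

lemma mul_dotProduct_le_of_le_eigenvalues {n : ℕ} {A : Matrix (Fin n) (Fin n) ℝ}
    (hA : A.IsHermitian) {l : ℝ} (hl : ∀ i, l ≤ hA.eigenvalues i) (x : Fin n → ℝ) :
    l * (x ⬝ᵥ x) ≤ x ⬝ᵥ A *ᵥ x := by
  let U : Matrix (Fin n) (Fin n) ℝ := hA.eigenvectorUnitary
  have hU : U * Uᴴ = 1 := Unitary.coe_mul_star_self hA.eigenvectorUnitary
  have hs : A = U * diagonal hA.eigenvalues * Uᴴ := by
    conv_lhs => rw [hA.spectral_theorem]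
    simp [Unitary.conjStarAlgAut_apply, U, star_eq_conjTranspose]
  have h2 : A - l • (1 : Matrix (Fin n) (Fin n) ℝ) =
      U * diagonal (fun i => hA.eigenvalues i - l) * Uᴴ := by
    rw [show diagonal (fun i => hA.eigenvalues i - l) =
      diagonal hA.eigenvalues - l • (1 : Matrix (Fin n) (Fin n) ℝ) by
        ext i j; by_cases hij : i = j <;> simp [diagonal, hij, one_apply]]
    rw [Matrix.mul_sub, Matrix.sub_mul, ← hs, Matrix.mul_smul, Matrix.smul_mul, Matrix.mul_one, hU]
  have h3 : (A - l • (1 : Matrix (Fin n) (Fin n) ℝ)).PosSemidef := by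
    rw [h2]
    exact (posSemidef_diagonal_iff.2 fun i => sub_nonneg.2 (hl i)).mul_mul_conjTranspose_same U
  have h4 := h3.dotProduct_mulVec_nonneg x
  simp [sub_mulVec, smul_mulVec, dotProduct_sub] at h4
  linarith

/-- For a nonzero real vector with five entries, up to sign, either one or two entries are positive,
or the vector is nonnegative with at least three positive entries. -/
lemma card_pos_dichotomy {y : Fin 5 → ℝ} (hy : y ≠ 0) :
    ∃ ε : ℝ, (1 ≤ #{i | 0 < (ε • y) i} ∧ #{i | 0 < (ε • y) i} ≤ 2) ∨
      ((∀ i, 0 ≤ (ε • y) i) ∧ 3 ≤ #{i | 0 < (ε • y) i}) := by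
  by_contra! hcon
  have h1 := hcon 1
  have h2 := hcon (-1)
  simp only [one_smul, neg_smul, Pi.neg_apply, Left.neg_pos_iff, Left.nonneg_neg_iff] at h1 h2
  have hd : Disjoint (univ.filter fun i => 0 < y i) (univ.filter fun i => y i < 0) :=
    disjoint_filter.2 fun i _ h => not_lt.2 h.le
  have hc : #{i | 0 < y i} + #{i | y i < 0} ≤ 5 := by
    rw [← card_union_of_disjoint hd]
    exact (card_le_univ _).trans (by simp)
  have hz : #{i | 0 < y i} ≠ 0 ∨ #{i | y i < 0} ≠ 0 := by
    by_contra! h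
    obtain ⟨ha, hb⟩ := h
    rw [card_eq_zero, filter_eq_empty_iff] at ha hb
    exact hy (funext fun i => le_antisymm (not_lt.1 (ha (mem_univ i))) (not_lt.1 (hb (mem_univ i))))
  rcases Nat.eq_zero_or_pos (#{i | 0 < y i}) with h0 | h0
  · have := h2.2 fun i => not_lt.1 ((filter_eq_empty_iff.1 (card_eq_zero.1 h0)) (mem_univ i))
    omega
  · rcases Nat.eq_zero_or_pos (#{i | y i < 0}) with h0' | h0'
    · have := h1.2 fun i => not_lt.1 ((filter_eq_empty_iff.1 (card_eq_zero.1 h0')) (mem_univ i))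
      omega
    · omega

/-- Two nonnegative vectors with at least three positive entries each share a positive position
among five, so they cannot be orthogonal. -/
lemma exists_smul_card_pos_le_two {x y : Fin 5 → ℝ} (hx : x ≠ 0) (hy : y ≠ 0) (hxy : x ⬝ᵥ y = 0) :
    (∃ ε : ℝ, 1 ≤ #{i | 0 < (ε • x) i} ∧ #{i | 0 < (ε • x) i} ≤ 2) ∨
      ∃ ε : ℝ, 1 ≤ #{i | 0 < (ε • y) i} ∧ #{i | 0 < (ε • y) i} ≤ 2 := by
  obtain ⟨ε, h | ⟨h, h'⟩⟩ := card_pos_dichotomy hx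
  · exact Or.inl ⟨ε, h⟩
  obtain ⟨δ, k | ⟨k, k'⟩⟩ := card_pos_dichotomy hy
  · exact Or.inr ⟨δ, k⟩
  have h0 : (ε • x) ⬝ᵥ (δ • y) = 0 := by simp [hxy]
  obtain ⟨i, hi⟩ : ((univ.filter fun i => 0 < (ε • x) i) ∩
      (univ.filter fun i => 0 < (δ • y) i)).Nonempty := by
    rw [← card_pos]
    have h1 := card_union_add_card_inter (univ.filter fun i => 0 < (ε • x) i)
      (univ.filter fun i => 0 < (δ • y) i)
    have h2 := card_le_univ ((univ.filter fun i => 0 < (ε • x) i) ∪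
      (univ.filter fun i => 0 < (δ • y) i))
    rw [Fintype.card_fin] at h2
    omega
  simp only [mem_inter, mem_filter, mem_univ, true_and] at hi
  have h1 := (sum_eq_zero_iff_of_nonneg fun i _ => mul_nonneg (h i) (k i)).1 h0 i (mem_univ i)
  exact absurd h1 (mul_pos hi.1 hi.2).ne'

/-- The McDonald–Neumann inequality. -/
lemma add_le_sum_of_symmRealizable {σ : Fin 5 → ℝ} (hσ : Antitone σ) (h : SymmRealizable σ) :
    0 ≤ ∑ j, σ j ∧ σ 1 + σ 4 ≤ ∑ j, σ j := by
  obtain ⟨A, hsymm, hnn, hspec⟩ := h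
  have hA : A.IsHermitian := by rw [IsHermitian, conjTranspose_eq_transpose_of_trivial]; exact hsymm
  have hmap := hspec.map_eigenvalues hA
  have htr : ∑ j, σ j = ∑ j, A j j := by
    have h1 : A.trace = ∑ i, hA.eigenvalues i := by simpa using hA.trace_eq_sum_eigenvalues
    calc ∑ j, σ j = (Multiset.map σ univ.val).sum := rfl
      _ = ∑ i, hA.eigenvalues i := by rw [← hmap]; rfl
      _ = ∑ j, A j j := h1.symm
  have hl : ∀ i, σ 4 ≤ hA.eigenvalues i := by
    intro i
    have : hA.eigenvalues i ∈ Multiset.map hA.eigenvalues univ.val :=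
      Multiset.mem_map_of_mem _ (mem_univ i)
    rw [hmap] at this
    obtain ⟨j, -, hj⟩ := Multiset.mem_map.1 this
    rw [← hj]
    exact hσ (Fin.le_last j)
  have hcard : #{i | σ 1 ≤ hA.eigenvalues i} = #{i | σ 1 ≤ σ i} := by
    have := congrArg (Multiset.countP (σ 1 ≤ ·)) hmap
    rw [Multiset.countP_map, Multiset.countP_map] at this
    exact this
  -- Two orthogonal eigenvectors with eigenvalue at least `σ 1` are needed; counting with
  -- multiplicity covers `σ 0 = σ 1`.
  have h2 : 1 < #{i | σ 1 ≤ hA.eigenvalues i} := by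
    rw [hcard]
    exact one_lt_card.2 ⟨0, by simpa using hσ (Fin.zero_le 1), 1, by simp, by decide⟩
  obtain ⟨i, hi, j, hj, hij⟩ := one_lt_card.1 h2
  simp only [mem_filter, mem_univ, true_and] at hi hj
  have key : ∀ i, σ 1 ≤ hA.eigenvalues i → ∀ ε : ℝ,
      1 ≤ #{k | 0 < (ε • (hA.eigenvectorBasis i).ofLp) k} →
      #{k | 0 < (ε • (hA.eigenvectorBasis i).ofLp) k} ≤ 2 → σ 1 + σ 4 ≤ ∑ j, A j j := by
    intro i hi ε c1 c2
    obtain ⟨a, b, hab, ha, hk⟩ := exists_pair_of_card_pos_le_two c1 c2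
    have hy : A *ᵥ (ε • (hA.eigenvectorBasis i).ofLp) =
        hA.eigenvalues i • (ε • (hA.eigenvectorBasis i).ofLp) := by
      rw [mulVec_smul, hA.mulVec_eigenvectorBasis, smul_comm]
    have h1 := add_le_diag_add_diag hsymm hnn (mul_dotProduct_le_of_le_eigenvalues hA hl) hy hab
      ha hk
    have h3 : ∑ k ∈ {a, b}, A k k ≤ ∑ j, A j j :=
      sum_le_sum_of_subset_of_nonneg (subset_univ _) fun k _ _ => hnn k k
    rw [sum_pair hab] at h3
    linarith
  refine ⟨htr ▸ sum_nonneg fun k _ => hnn k k, htr ▸ ?_⟩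
  have hne : ∀ i, (hA.eigenvectorBasis i).ofLp ≠ 0 := fun i h0 =>
    hA.eigenvectorBasis.orthonormal.ne_zero i (by ext k; simp [h0])
  have horth : (hA.eigenvectorBasis i).ofLp ⬝ᵥ (hA.eigenvectorBasis j).ofLp = 0 := by
    have : inner ℝ (hA.eigenvectorBasis j) (hA.eigenvectorBasis i) = 0 :=
      hA.eigenvectorBasis.orthonormal.2 hij.symm
    rw [EuclideanSpace.inner_eq_star_dotProduct] at this
    simpa using this
  obtain ⟨ε, c1, c2⟩ | ⟨ε, c1, c2⟩ := exists_smul_card_pos_le_two (hne i) (hne j) horth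
  · exact key i hi ε c1 c2
  · exact key j hj ε c1 c2

end Necessity

/-- Sufficient conditions for a list that need not be sorted. -/
lemma symmRealizable_of_bounds {g : Fin 5 → ℝ} {B : ℝ} (hlow : ∀ k, -g 0 ≤ g k)
    (hsum : 0 ≤ ∑ j, g j) (hthird : ∀ k, k ≠ 0 → k ≠ 1 → g k ≤ ∑ j, g j)
    (hB : ∀ k, k ≠ 0 → g k ≤ B) (hMN : B + g 4 ≤ ∑ j, g j) : SymmRealizable g := by
  obtain ⟨τ, hτ⟩ : ∃ τ : Equiv.Perm (Fin 5), Antitone (g ∘ τ) :=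
    ⟨Tuple.sort (OrderDual.toDual ∘ g), fun i j hij =>
      Tuple.monotone_sort (OrderDual.toDual ∘ g) hij⟩
  have hs : ∑ j, (g ∘ τ) j = ∑ j, g j := Equiv.sum_comp τ g
  have hle : ∀ k, g k ≤ g (τ 0) := fun k => by
    simpa using hτ (Fin.zero_le (τ.symm k))
  have hge : ∀ k, g (τ 4) ≤ g k := fun k => by
    simpa using hτ (Fin.le_last (τ.symm k))
  have h01 : g (τ 1) ≤ g (τ 0) := hle _
  have h12 : g (τ 2) ≤ g (τ 1) := hτ (by decide : (1 : Fin 5) ≤ 2)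
  have n01 : τ 0 ≠ τ 1 := τ.injective.ne (by decide)
  have n02 : τ 0 ≠ τ 2 := τ.injective.ne (by decide)
  have n12 : τ 1 ≠ τ 2 := τ.injective.ne (by decide)
  refine SymmRealizable.of_comp_perm τ (symmRealizable_of_sorted hτ ?_ ?_ ?_ ?_)
  · have h1 := hlow (τ 4)
    have h2 := hle 0
    simp only [Function.comp_apply]
    linarith
  · rwa [hs]
  · rw [hs, Function.comp_apply]
    -- Of the three largest positions, one lies outside `{0, 1}`; its value bounds the third
    -- largest.
    by_cases a0 : τ 2 = 0 ∨ τ 2 = 1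
    · by_cases a1 : τ 1 = 0 ∨ τ 1 = 1
      · have := hthird (τ 0) (by grind) (by grind)
        linarith
      · have := hthird (τ 1) (by grind) (by grind)
        linarith
    · exact hthird _ (by grind) (by grind)
  · rw [hs, Function.comp_apply, Function.comp_apply]
    have h1 : g (τ 1) ≤ B := by
      by_cases a : τ 1 = 0
      · exact h01.trans (hB _ (by grind))
      · exact hB _ a
    have := hge 4
    linarith

end SNIEP

theorem mainTheorem5 (σ : Fin 5 → ℝ) (hdesc : Antitone σ) (hlow : -σ 0 ≤ σ 4)
    (hthird : σ 2 ≤ ∑ j, σ j) (hreal : SNIEP.SymmRealizable σ) :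
    ∀ s : ℝ, 0 < s → ∀ i : Fin 5, i ≠ 0 →
      SNIEP.SymmRealizable (SNIEP.perturbPlus σ i s) ∧
      SNIEP.SymmRealizable (SNIEP.perturbMinus σ i s) := by
  intro s hs i hi
  obtain ⟨h0, hMN⟩ := SNIEP.add_le_sum_of_symmRealizable hdesc hreal
  have hmin : ∀ k, σ 4 ≤ σ k := fun k => hdesc (Fin.le_last k)
  have hB : ∀ k, k ≠ 0 → σ k ≤ σ 1 := fun k hk => hdesc (Fin.one_le_of_ne_zero hk)
  have hC : ∀ k : Fin 5, k ≠ 0 → k ≠ 1 → σ k ≤ σ 2 := fun k hk hk' => hdesc (by omega)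
  have hplus : ∑ j, SNIEP.perturbPlus σ i s j = ∑ j, σ j + 2 * s := by
    fin_cases i <;> simp [SNIEP.perturbPlus, Fin.sum_univ_five] at hi ⊢ <;> ring
  have hminus : ∑ j, SNIEP.perturbMinus σ i s j = ∑ j, σ j := by
    fin_cases i <;> simp [SNIEP.perturbMinus, Fin.sum_univ_five] at hi ⊢ <;> ring
  constructor
  · have hp0 : SNIEP.perturbPlus σ i s 0 = σ 0 + s := if_pos rfl
    have hp : ∀ k, k ≠ 0 → σ k ≤ SNIEP.perturbPlus σ i s k ∧
        SNIEP.perturbPlus σ i s k ≤ σ k + s := by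
      intro k hk
      rw [SNIEP.perturbPlus, if_neg hk]
      split_ifs with h
      · subst h; constructor <;> linarith
      · constructor <;> linarith
    -- The bound on the second largest and the entry at `4` rise by at most `s` each, against a sum
    -- that rises by `2 * s`.
    refine SNIEP.symmRealizable_of_bounds (B := σ 1 + s) ?_ ?_ ?_ ?_ ?_
    · intro k
      rw [hp0]
      by_cases hk : k = 0
      · rw [hk, hp0]; linarith [hmin 0]
      · linarith [(hp k hk).1, hmin k]
    · rw [hplus]; linarith
    · intro k hk hk'
      rw [hplus]
      linarith [(hp k hk).2, hC k hk hk']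
    · intro k hk
      linarith [(hp k hk).2, hB k hk]
    · rw [hplus]
      linarith [(hp 4 (by decide)).2]
  · have hp0 : SNIEP.perturbMinus σ i s 0 = σ 0 + s := if_pos rfl
    have hp : ∀ k, k ≠ 0 → σ k - s ≤ SNIEP.perturbMinus σ i s k ∧
        SNIEP.perturbMinus σ i s k ≤ σ k := by
      intro k hk
      rw [SNIEP.perturbMinus, if_neg hk]
      split_ifs with h
      · subst h; constructor <;> linarith
      · constructor <;> linarith
    -- The sum is unchanged and no entry but the first grows; a drop by `s` is matched by the first
    -- entry's growth.
    refine SNIEP.symmRealizable_of_bounds (B := σ 1) ?_ ?_ ?_ ?_ ?_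
    · intro k
      rw [hp0]
      by_cases hk : k = 0
      · rw [hk, hp0]; linarith [hmin 0]
      · linarith [(hp k hk).1, hmin k]
    · rw [hminus]; linarith
    · intro k hk hk'
      rw [hminus]
      linarith [(hp k hk).2, hC k hk hk']
    · intro k hk
      linarith [(hp k hk).2, hB k hk]
    · rw [hminus]
      linarith [(hp 4 (by decide)).2]
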